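/- Let $S^1$ be the circle of radius $a>0$ with coordinate $x$, let $\mathcal V$ be a Hermitian vector bundle of rank $N$ over $S^1$, written in a parallel frame, so that its sections are the functions $f:\mathbb R\to\mathbb C^N$ with $f(x+2\pi a)=\rho f(x)$ for a fixed unitary $\rho$ (the periodic functions if $\rho=I$). Let $Q$ be a smooth Hermitian section of $\operatorname{End}\mathcal V$, that is, a smooth function with Hermitian $N\times N$ matrix values and $Q(x+2\pi a)=\rho\,Q(x)\rho^{-1}$. Let $D=\partial_x$ and $L=-D^2+Q$, and let $U(t;x,x')$ be the heat kernel of $L$: the fundamental solution of the heat equation, smooth for $t>0$, with $(\partial_t+L)U(t;x,x')=0$ and $U(0;x,x')=\delta(x-x')$. The initial condition means that, for every smooth section $f$, $\int_0^{2\pi a}U(t;x,x')f(x')\,dx'\to f(x)$ uniformly in $x$ as $t\to0^+$. Put $[U(t)](x)=U(t;x,x)$, $\mathrm{Ad}_QF=QF-FQ$, and $$W(t)(x)=(\partial_x-\partial_{x'})U(t;x,x')\big|_{x'=x},$$ the diagonal value of the kernel of $D\,U(t)+U(t)\,D$. Then for all $t>0$ one has $D\,W(t)=\mathrm{Ad}_Q[U(t)]$,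 and with this antiderivative $D^{-1}\mathrm{Ad}_Q[U(t)]:=W(t)$ the heat kernel diagonal satisfies $$(4\,\partial_t D-E)\,[U(t)]=0,\qquad E=D^3-2QD-2DQ+\mathrm{Ad}_QD+D\,\mathrm{Ad}_Q+\mathrm{Ad}_QD^{-1}\mathrm{Ad}_Q ,$$ where $QD$ and $DQ$ denote compositions of operators: $(QD)F=Q\,F'$ and $(DQ)F=(QF)'$. In the scalar case $N=1$ the operator $E$ reduces to $D^3-2QD-2DQ$. -/

import Mathlib

open Filter Topology
open scoped ContDiff

namespace CircleHeat

/-- The typical fibre of the rank `N` Hermitian vector bundle over the circle. -/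
abbrev Fiber (N : ℕ) : Type := EuclideanSpace ℂ (Fin N)

/-- Endomorphisms of the fibre, i.e. complex `N × N` matrices acting on `ℂ ^ N`;
the ring multiplication is composition and `star` is the Hermitian adjoint. -/
abbrev FiberEnd (N : ℕ) : Type := Fiber N →L[ℂ] Fiber N

/-- Sections over the circle of radius `a` of the bundle with holonomy `ρ`, written in the
coordinate `x` in a parallel frame: functions on the line with `f (x + 2πa) = ρ (f x)`.
For `ρ = 1` these are the periodic functions. -/
def IsSection {N : ℕ} (a : ℝ) (ρ : FiberEnd N) (f : ℝ → Fiber N) : Prop :=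
  ∀ x, f (x + 2 * Real.pi * a) = ρ (f x)

/-- Sections of the endomorphism bundle: `F (x + 2πa) = ρ F(x) ρ⁻¹`. -/
def IsEndSection {N : ℕ} (a : ℝ) (ρ : FiberEnd N) (F : ℝ → FiberEnd N) : Prop :=
  ∀ x, F (x + 2 * Real.pi * a) * ρ = ρ * F x

/-- The operator `L = -D² + Q`, with `D = d/dx` (acting on each column of `F`). -/
noncomputable def schrodinger {N : ℕ} (Q : ℝ → FiberEnd N) (F : ℝ → FiberEnd N) (x : ℝ) :
    FiberEnd N :=
  -iteratedDeriv 2 F x + Q x * F x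

/-- `U t x x'` is the heat kernel of `L = -D² + Q` on the circle of radius `a`, i.e. the
fundamental solution of the heat equation: for positive time it is a smooth two-point
section, it solves `(∂ₜ + L) U = 0` in the variable `x`, and `U (0; x, x') = δ(x - x')`.
The values at `t ≤ 0` are irrelevant. -/
structure IsHeatKernel {N : ℕ} (a : ℝ) (ρ : FiberEnd N) (Q : ℝ → FiberEnd N)
    (U : ℝ → ℝ → ℝ → FiberEnd N) : Prop where
  smooth : ContDiffOn ℝ ∞ (fun p : ℝ × ℝ × ℝ => U p.1 p.2.1 p.2.2)
    (Set.Ioi (0 : ℝ) ×ˢ Set.univ)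
  left_section : ∀ t, 0 < t → ∀ x x', U t (x + 2 * Real.pi * a) x' = ρ * U t x x'
  right_section : ∀ t, 0 < t → ∀ x x', U t x (x' + 2 * Real.pi * a) * ρ = U t x x'
  heat_equation : ∀ t, 0 < t → ∀ x x',
    deriv (fun s => U s x x') t + schrodinger Q (fun y => U t y x') x = 0
  initial : ∀ f : ℝ → Fiber N, ContDiff ℝ ∞ f → IsSection a ρ f →
    TendstoUniformly (fun t x => ∫ x' in (0 : ℝ)..(2 * Real.pi * a), U t x x' (f x')) f
      (𝓝[>] (0 : ℝ))

/-- The diagonal value `[U(t)](x) = U(t; x, x)`. -/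
def diagonal {N : ℕ} (U : ℝ → ℝ → ℝ → FiberEnd N) (t x : ℝ) : FiberEnd N := U t x x

/-- The diagonal value of the kernel of `D U(t) + U(t) D`, namely
`W(t)(x) = (∂_x - ∂_{x'}) U(t; x, x')` at `x' = x`. -/
noncomputable def kernelW {N : ℕ} (U : ℝ → ℝ → ℝ → FiberEnd N) (t x : ℝ) : FiberEnd N :=
  deriv (fun y => U t y x) x - deriv (fun y => U t x y) x

/-- `Ad_Q F = [Q, F]`, pointwise commutator of matrix-valued functions. -/
noncomputable def adQ {N : ℕ} (Q F : ℝ → FiberEnd N) (x : ℝ) : FiberEnd N := Q x * F x - F x * Q x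

/-- The operator `E = D³ - 2QD - 2DQ + Ad_Q D + D Ad_Q + Ad_Q D⁻¹ Ad_Q` applied to `F`,
where `G` is the value of `D⁻¹ Ad_Q F` (an antiderivative of `Ad_Q F`). -/
noncomputable def opE {N : ℕ} (Q F G : ℝ → FiberEnd N) (x : ℝ) : FiberEnd N :=
  iteratedDeriv 3 F x - 2 * (Q x * deriv F x) - 2 * deriv (fun y => Q y * F y) x
    + adQ Q (deriv F) x + deriv (adQ Q F) x + adQ Q G x

/-- The differential operator `D³ - 2QD - 2DQ` applied to `F`. -/
noncomputable def scalarE {N : ℕ} (Q F : ℝ → FiberEnd N) (x : ℝ) : FiberEnd N :=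
  iteratedDeriv 3 F x - 2 * (Q x * deriv F x) - 2 * deriv (fun y => Q y * F y) x

end CircleHeat

/-! On the diagonal, $D$ acts as $\partial_x+\partial_y$. If $U$ satisfies the heat equation in each
space variable, $\partial_tU=\partial_x^2U-QU=\partial_y^2U-UQ$, then subtracting gives
$(\partial_x+\partial_y)(\partial_x-\partial_y)U=[Q,U]$ on the diagonal, which is the claim on $W$
(`hasDerivAt_antisymm`). For the third-order equation, $(\partial_x+\partial_y)^3$ has coefficients
1, 3, 3, 1, and $4(\partial_x+\partial_y)\partial_tU$ produces the same pattern when the two forms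
of $\partial_tU$ are used in the ratio 1 : 3 for $\partial_x$ and 3 : 1 for $\partial_y$
(`deriv_diag_third_order`). The remaining terms match by `third_order_identity`.

Only the equation in $x$ is assumed. The one in $y$ is its adjoint, once $U(t;x,y)^*=U(t;y,x)$ is
known (`star_eq`). To get this, consider $U(t-r)^*U(r)$, where the adjoint places both integration
variables in the first slot. Green's formula shows that it does not depend on $r$; letting $r\to t$
in a pairing with smooth sections identifies it with $U(t)$; and at $r=t/2$ it is visibly Hermitian.
-/

namespace CircleHeat

/-! ### Partial derivatives of two-point functions and identities on the diagonal. -/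

section Calculus

variable {A : Type*} [NormedRing A] [NormedAlgebra ℝ A]

/-- The derivative of `P` in the direction `v`. -/
noncomputable def dirDeriv {V W : Type*} [NormedAddCommGroup V] [NormedSpace ℝ V]
    [NormedAddCommGroup W] [NormedSpace ℝ W] (v : V) (P : V → W) (p : V) : W :=
  fderiv ℝ P p v

section DirDeriv

variable {V W : Type*} [NormedAddCommGroup V] [NormedSpace ℝ V]
    [NormedAddCommGroup W] [NormedSpace ℝ W] {S : Set V} {P : V → W}

theorem contDiffOn_dirDeriv (hS : IsOpen S) (hP : ContDiffOn ℝ ∞ P S) (v : V) :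
    ContDiffOn ℝ ∞ (dirDeriv v P) S :=
  (hP.fderiv_of_isOpen hS (m := ∞) le_rfl).clm_apply contDiffOn_const

theorem hasDerivAt_dirDeriv (hS : IsOpen S) (hP : ContDiffOn ℝ ∞ P S) {γ : ℝ → V} {v : V} {s : ℝ}
    (hγ : HasDerivAt γ v s) (hs : γ s ∈ S) :
    HasDerivAt (fun r => P (γ r)) (dirDeriv v P (γ s)) s :=
  (((hP.contDiffAt (hS.mem_nhds hs)).differentiableAt (by simp)).hasFDerivAt).comp_hasDerivAt s hγ

theorem dirDeriv_comm (hS : IsOpen S) (hP : ContDiffOn ℝ ∞ P S) (v w : V) {p : V} (hp : p ∈ S) :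
    dirDeriv v (dirDeriv w P) p = dirDeriv w (dirDeriv v P) p := by
  have hc := hP.contDiffAt (hS.mem_nhds hp)
  have hd : DifferentiableAt ℝ (fderiv ℝ P) p :=
    (hc.fderiv_right (m := ∞) le_rfl).differentiableAt (by simp)
  have key : ∀ v w : V, dirDeriv v (dirDeriv w P) p = fderiv ℝ (fderiv ℝ P) p v w := by
    intro v w
    have : HasFDerivAt (dirDeriv w P) _ p := hd.hasFDerivAt.clm_apply (hasFDerivAt_const w p)
    rw [dirDeriv, this.fderiv]
    simp
  rw [key, key]
  exact hc.isSymmSndFDerivAt (by simpa using ENat.LEInfty.out) v w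

theorem dirDeriv_add (v w : V) (P : V → W) (p : V) :
    dirDeriv (v + w) P p = dirDeriv v P p + dirDeriv w P p := map_add _ _ _

theorem dirDeriv_congr (hS : IsOpen S) {R : V → W} (h : Set.EqOn P R S) (v : V) :
    Set.EqOn (dirDeriv v P) (dirDeriv v R) S := fun p hp => by
  unfold dirDeriv
  rw [(h.eventuallyEq_of_mem (hS.mem_nhds hp)).fderiv_eq]

end DirDeriv

/-- The domain of two-point functions at positive time. -/
def posTime : Set (ℝ × ℝ × ℝ) := Set.Ioi (0 : ℝ) ×ˢ Set.univ

theorem isOpen_posTime : IsOpen posTime := isOpen_Ioi.prod isOpen_univ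

theorem mem_posTime {t x y : ℝ} (ht : 0 < t) : (t, x, y) ∈ posTime := ⟨ht, trivial⟩

/-- The time derivative. -/
noncomputable abbrev dT {W : Type*} [NormedAddCommGroup W] [NormedSpace ℝ W] :
    (ℝ × ℝ × ℝ → W) → ℝ × ℝ × ℝ → W := dirDeriv (1, 0, 0)
/-- The derivative in the first space variable. -/
noncomputable abbrev dX {W : Type*} [NormedAddCommGroup W] [NormedSpace ℝ W] :
    (ℝ × ℝ × ℝ → W) → ℝ × ℝ × ℝ → W := dirDeriv (0, 1, 0)
/-- The derivative in the second space variable. -/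
noncomputable abbrev dY {W : Type*} [NormedAddCommGroup W] [NormedSpace ℝ W] :
    (ℝ × ℝ × ℝ → W) → ℝ × ℝ × ℝ → W := dirDeriv (0, 0, 1)

section Curves

variable {W : Type*} [NormedAddCommGroup W] [NormedSpace ℝ W] {P : ℝ × ℝ × ℝ → W}
  (hP : ContDiffOn ℝ ∞ P posTime) {t : ℝ} (ht : 0 < t) (x y : ℝ)
include hP ht

theorem hasDerivAt_dT : HasDerivAt (fun s => P (s, x, y)) (dT P (t, x, y)) t :=
  hasDerivAt_dirDeriv isOpen_posTime hP (γ := fun s => (s, x, y))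
    ((hasDerivAt_id t).prodMk ((hasDerivAt_const t x).prodMk (hasDerivAt_const t y)))
    (mem_posTime ht)

theorem hasDerivAt_dX : HasDerivAt (fun s => P (t, s, y)) (dX P (t, x, y)) x :=
  hasDerivAt_dirDeriv isOpen_posTime hP (γ := fun s => (t, s, y))
    ((hasDerivAt_const x t).prodMk ((hasDerivAt_id x).prodMk (hasDerivAt_const x y)))
    (mem_posTime ht)

theorem hasDerivAt_dY : HasDerivAt (fun s => P (t, x, s)) (dY P (t, x, y)) y :=
  hasDerivAt_dirDeriv isOpen_posTime hP (γ := fun s => (t, x, s))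
    ((hasDerivAt_const y t).prodMk ((hasDerivAt_const y x).prodMk (hasDerivAt_id y)))
    (mem_posTime ht)

theorem hasDerivAt_diag :
    HasDerivAt (fun s => P (t, s, s)) (dX P (t, x, x) + dY P (t, x, x)) x := by
  have := hasDerivAt_dirDeriv isOpen_posTime hP (γ := fun s => (t, s, s))
    ((hasDerivAt_const x t).prodMk ((hasDerivAt_id x).prodMk (hasDerivAt_id x)))
    (mem_posTime ht)
  rwa [show ((0 : ℝ), (1 : ℝ), (1 : ℝ)) = (0, 1, 0) + (0, 0, 1) by simp, dirDeriv_add] at this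

end Curves

variable {P : ℝ × ℝ × ℝ → A} {Q : ℝ → A}

/-- Since mixed partials commute,
$(\partial_x+\partial_y)(\partial_x-\partial_y)=\partial_x^2-\partial_y^2$, and the difference of
the two heat equations evaluates this at $y=x$. -/
theorem hasDerivAt_antisymm (hP : ContDiffOn ℝ ∞ P posTime)
    (h₁ : ∀ t, 0 < t → ∀ x y, dT P (t, x, y) = dX (dX P) (t, x, y) - Q x * P (t, x, y))
    (h₂ : ∀ t, 0 < t → ∀ x y, dT P (t, x, y) = dY (dY P) (t, x, y) - P (t, x, y) * Q y)
    {t : ℝ} (ht : 0 < t) (x : ℝ) :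
    HasDerivAt (fun s => dX P (t, s, s) - dY P (t, s, s))
      (Q x * P (t, x, x) - P (t, x, x) * Q x) x := by
  have hX : ContDiffOn ℝ ∞ (dX P) posTime := contDiffOn_dirDeriv isOpen_posTime hP _
  have hY : ContDiffOn ℝ ∞ (dY P) posTime := contDiffOn_dirDeriv isOpen_posTime hP _
  refine ((hasDerivAt_diag hX ht x).sub (hasDerivAt_diag hY ht x)).congr_deriv ?_
  have e : dX (dX P) (t, x, x) - dY (dY P) (t, x, x) = Q x * P (t, x, x) - P (t, x, x) * Q x := by
    have e₁ := h₁ t ht x x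
    rw [h₂ t ht x x, sub_eq_sub_iff_add_eq_add] at e₁
    rw [sub_eq_sub_iff_add_eq_add, ← e₁, add_comm]
  have comm : dX (dY P) (t, x, x) = dY (dX P) (t, x, x) :=
    dirDeriv_comm isOpen_posTime hP _ _ (mem_posTime ht)
  rw [comm, ← e]
  abel

/-- Third order equation on the diagonal for a solution of both heat equations. -/
theorem deriv_diag_third_order (hP : ContDiffOn ℝ ∞ P posTime) (hQ : ContDiff ℝ ∞ Q)
    (h₁ : ∀ t, 0 < t → ∀ x y, dT P (t, x, y) = dX (dX P) (t, x, y) - Q x * P (t, x, y))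
    (h₂ : ∀ t, 0 < t → ∀ x y, dT P (t, x, y) = dY (dY P) (t, x, y) - P (t, x, y) * Q y)
    {t : ℝ} (ht : 0 < t) (x : ℝ) :
    4 * deriv (fun s => deriv (fun z => P (s, z, z)) x) t =
      iteratedDeriv 3 (fun z => P (t, z, z)) x
      - deriv Q x * P (t, x, x) - P (t, x, x) * deriv Q x
      - Q x * dX P (t, x, x) - 3 * (Q x * dY P (t, x, x))
      - 3 * (dX P (t, x, x) * Q x) - dY P (t, x, x) * Q x := by
  have hX : ContDiffOn ℝ ∞ (dX P) posTime := contDiffOn_dirDeriv isOpen_posTime hP _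
  have hY : ContDiffOn ℝ ∞ (dY P) posTime := contDiffOn_dirDeriv isOpen_posTime hP _
  have hT : ContDiffOn ℝ ∞ (dT P) posTime := contDiffOn_dirDeriv isOpen_posTime hP _
  have hXX : ContDiffOn ℝ ∞ (dX (dX P)) posTime := contDiffOn_dirDeriv isOpen_posTime hX _
  have hYX : ContDiffOn ℝ ∞ (dY (dX P)) posTime := contDiffOn_dirDeriv isOpen_posTime hX _
  have hXY : ContDiffOn ℝ ∞ (dX (dY P)) posTime := contDiffOn_dirDeriv isOpen_posTime hY _
  have hYY : ContDiffOn ℝ ∞ (dY (dY P)) posTime := contDiffOn_dirDeriv isOpen_posTime hY _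
  have hq : HasDerivAt Q (deriv Q x) x := (hQ.differentiable (by simp) x).hasDerivAt
  have mem := mem_posTime (x := x) (y := x) ht
  have d1 : ∀ s, 0 < s → deriv (fun z => P (s, z, z)) =
      fun z => dX P (s, z, z) + dY P (s, z, z) :=
    fun s hs => funext fun z => (hasDerivAt_diag hP hs z).deriv
  have d2 : deriv (fun z => dX P (t, z, z) + dY P (t, z, z)) = fun z =>
      dX (dX P) (t, z, z) + dY (dX P) (t, z, z) + (dX (dY P) (t, z, z) + dY (dY P) (t, z, z)) :=
    funext fun z => ((hasDerivAt_diag hX ht z).add (hasDerivAt_diag hY ht z)).deriv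
  have d3 := (((hasDerivAt_diag hXX ht x).add (hasDerivAt_diag hYX ht x)).add
    ((hasDerivAt_diag hXY ht x).add (hasDerivAt_diag hYY ht x))).deriv
  have i3 : iteratedDeriv 3 (fun z => P (t, z, z)) x =
      dX (dX (dX P)) (t, x, x) + dY (dX (dX P)) (t, x, x)
        + (dX (dY (dX P)) (t, x, x) + dY (dY (dX P)) (t, x, x))
        + (dX (dX (dY P)) (t, x, x) + dY (dX (dY P)) (t, x, x)
        + (dX (dY (dY P)) (t, x, x) + dY (dY (dY P)) (t, x, x))) := by
    rw [iteratedDeriv_succ, iteratedDeriv_succ, iteratedDeriv_one, d1 t ht, d2]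
    exact d3
  have dt : deriv (fun s => deriv (fun z => P (s, z, z)) x) t =
      dX (dT P) (t, x, x) + dY (dT P) (t, x, x) := by
    have hev : (fun s => deriv (fun z => P (s, z, z)) x) =ᶠ[𝓝 t]
        fun s => dX P (s, x, x) + dY P (s, x, x) := by
      filter_upwards [lt_mem_nhds ht] with s hs
      rw [d1 s hs]
    refine hev.deriv_eq.trans
      (((hasDerivAt_dT hX ht x x).add (hasDerivAt_dT hY ht x x)).deriv.trans ?_)
    exact congrArg₂ (· + ·) (dirDeriv_comm isOpen_posTime hP _ _ mem)
      (dirDeriv_comm isOpen_posTime hP _ _ mem)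
  -- Each space derivative of $\partial_tP$ is computed twice, once from each heat equation: `a1`,
  -- `a2` for $\partial_x$ and `a3`, `a4` for $\partial_y$.
  have a1 : dX (dT P) (t, x, x) =
      dX (dX (dX P)) (t, x, x) - (deriv Q x * P (t, x, x) + Q x * dX P (t, x, x)) :=
    ((hasDerivAt_dX hT ht x x).congr_of_eventuallyEq
      (Eventually.of_forall fun z => (h₁ t ht z x).symm)).unique
      ((hasDerivAt_dX hXX ht x x).sub (hq.mul (hasDerivAt_dX hP ht x x)))
  have a2 : dX (dT P) (t, x, x) = dX (dY (dY P)) (t, x, x) - dX P (t, x, x) * Q x :=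
    ((hasDerivAt_dX hT ht x x).congr_of_eventuallyEq
      (Eventually.of_forall fun z => (h₂ t ht z x).symm)).unique
      ((hasDerivAt_dX hYY ht x x).sub ((hasDerivAt_dX hP ht x x).mul_const _))
  have a3 : dY (dT P) (t, x, x) = dY (dX (dX P)) (t, x, x) - Q x * dY P (t, x, x) :=
    ((hasDerivAt_dY hT ht x x).congr_of_eventuallyEq
      (Eventually.of_forall fun z => (h₁ t ht x z).symm)).unique
      ((hasDerivAt_dY hXX ht x x).sub ((hasDerivAt_dY hP ht x x).const_mul _))
  have a4 : dY (dT P) (t, x, x) =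
      dY (dY (dY P)) (t, x, x) - (dY P (t, x, x) * Q x + P (t, x, x) * deriv Q x) :=
    ((hasDerivAt_dY hT ht x x).congr_of_eventuallyEq
      (Eventually.of_forall fun z => (h₂ t ht x z).symm)).unique
      ((hasDerivAt_dY hYY ht x x).sub ((hasDerivAt_dY hP ht x x).mul hq))
  have comm : Set.EqOn (dX (dY P)) (dY (dX P)) posTime :=
    fun p hp => dirDeriv_comm isOpen_posTime hP _ _ hp
  have c1 : dX (dY (dX P)) (t, x, x) = dY (dX (dX P)) (t, x, x) :=
    dirDeriv_comm isOpen_posTime hX _ _ mem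
  have c2 : dX (dX (dY P)) (t, x, x) = dY (dX (dX P)) (t, x, x) :=
    (dirDeriv_congr isOpen_posTime comm _ mem).trans c1
  have c3 : dY (dX (dY P)) (t, x, x) = dX (dY (dY P)) (t, x, x) :=
    (dirDeriv_comm isOpen_posTime hY _ _ mem)
  have c4 : dY (dY (dX P)) (t, x, x) = dX (dY (dY P)) (t, x, x) :=
    (dirDeriv_congr isOpen_posTime comm _ mem).symm.trans c3
  rw [dt, i3, c1, c2, c3, c4]
  -- The splitting 4 = 1 + 3 = 3 + 1 reproduces the binomial coefficients of
  -- $(\partial_x+\partial_y)^3$, so all third derivatives cancel.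
  have e : 4 * (dX (dT P) (t, x, x) + dY (dT P) (t, x, x)) =
      dX (dT P) (t, x, x) + 3 * dX (dT P) (t, x, x)
        + (3 * dY (dT P) (t, x, x) + dY (dT P) (t, x, x)) := by noncomm_ring
  rw [e]
  nth_rewrite 1 [a1]
  nth_rewrite 1 [a2]
  nth_rewrite 1 [a3]
  rw [a4]
  noncomm_ring

end Calculus


/-! ### Integrals depending on a parameter. -/

section Parametric

variable {E : Type*} [NormedAddCommGroup E] [NormedSpace ℝ E]

/-- Differentiation under an interval integral with jointly continuous derivative. -/
theorem hasDerivAt_intervalIntegral_param {F F' : ℝ → ℝ → E} {s : Set ℝ} (hs : IsOpen s)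
    (hF : ContinuousOn (fun p : ℝ × ℝ => F p.1 p.2) (s ×ˢ Set.univ))
    (hF' : ContinuousOn (fun p : ℝ × ℝ => F' p.1 p.2) (s ×ˢ Set.univ))
    (hd : ∀ r ∈ s, ∀ y, HasDerivAt (fun z => F z y) (F' r y) r) {r : ℝ} (hr : r ∈ s) (a b : ℝ) :
    HasDerivAt (fun z => ∫ y in a..b, F z y) (∫ y in a..b, F' r y) r := by
  obtain ⟨ε, hε, hball⟩ := Metric.nhds_basis_closedBall.mem_iff.mp (hs.mem_nhds hr)
  have slice : ∀ {G : ℝ → ℝ → E}, ContinuousOn (fun p : ℝ × ℝ => G p.1 p.2) (s ×ˢ Set.univ) →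
      ∀ z ∈ s, Continuous (G z) := fun hG z hz =>
    continuousOn_univ.mp (hG.comp (f := fun y => (z, y)) (by fun_prop) fun y _ => ⟨hz, trivial⟩)
  obtain ⟨C, hC⟩ := ((isCompact_closedBall r ε).prod (isCompact_uIcc (a := a) (b := b)))
    |>.exists_bound_of_continuousOn (hF'.mono (Set.prod_mono hball (Set.subset_univ _)))
  refine (intervalIntegral.hasDerivAt_integral_of_dominated_loc_of_deriv_le
    (bound := fun _ => C) (Metric.closedBall_mem_nhds r hε) ?_ ?_ ?_ ?_ ?_ ?_).2
  · filter_upwards [hs.mem_nhds hr] with z hz using (slice hF z hz).aestronglyMeasurable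
  · exact (slice hF r hr).intervalIntegrable _ _
  · exact (slice hF' r hr).aestronglyMeasurable
  · exact Eventually.of_forall fun y hy z hz => hC (z, y) ⟨hz, Set.uIoc_subset_uIcc hy⟩
  · exact intervalIntegrable_const
  · exact Eventually.of_forall fun y _ z hz => hd z (hball hz) y

/-- The derivative is an integral of the same kind, so induction on the order works for all
integrands at once. It makes the composed kernel an admissible test section. -/
theorem contDiff_intervalIntegral_param {F : ℝ × ℝ → E} (hF : ContDiff ℝ ∞ F) (a b : ℝ) :
    ContDiff ℝ ∞ (fun x => ∫ y in a..b, F (x, y)) := by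
  rw [contDiff_infty]
  intro n
  induction n generalizing F with
  | zero =>
    exact contDiff_zero.mpr (intervalIntegral.continuous_parametric_intervalIntegral_of_continuous'
      (f := fun x y => F (x, y)) hF.continuous a b)
  | succ n ih =>
    have hF' : ContDiff ℝ ∞ (fun p => fderiv ℝ F p ((1 : ℝ), (0 : ℝ))) :=
      (hF.fderiv_right (m := ∞) le_rfl).clm_apply contDiff_const
    have key : ∀ x, HasDerivAt (fun z => ∫ y in a..b, F (z, y))
        (∫ y in a..b, fderiv ℝ F (x, y) (1, 0)) x := fun x =>
      hasDerivAt_intervalIntegral_param (F := fun z y => F (z, y))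
        (F' := fun z y => fderiv ℝ F (z, y) (1, 0)) isOpen_univ hF.continuous.continuousOn
        hF'.continuous.continuousOn
        (fun r _ y => ((hF.differentiable (by simp)) (r, y)).hasFDerivAt.comp_hasDerivAt r
          ((hasDerivAt_id r).prodMk (hasDerivAt_const r y))) (Set.mem_univ x) a b
    push_cast
    rw [contDiff_succ_iff_deriv]
    refine ⟨fun x => (key x).differentiableAt, by simp, ?_⟩
    rw [funext fun x => (key x).deriv]
    exact ih hF'

end Parametric

/-! ### Inner products integrated over a period. -/

section Inner

variable {H : Type*} [NormedAddCommGroup H] [InnerProductSpace ℂ H]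

/-- A continuous function of periodic norm, orthogonal to itself over one period, vanishes. -/
theorem eq_zero_of_intervalIntegral_inner_self {f : ℝ → H} (hf : Continuous f) {T : ℝ} (hT : 0 < T)
    (hper : ∀ x, ‖f (x + T)‖ = ‖f x‖) (h : ∫ x in (0 : ℝ)..T, inner ℂ (f x) (f x) = 0) (x : ℝ) :
    f x = 0 := by
  by_contra hx
  have h' : ∫ x in (0 : ℝ)..T, ‖f x‖ ^ 2 = 0 := by
    have e : ∀ x, inner ℂ (f x) (f x) = ((‖f x‖ ^ 2 : ℝ) : ℂ) := fun x => by
      rw [inner_self_eq_norm_sq_to_K]; norm_cast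
    simp only [e] at h
    rw [intervalIntegral.integral_ofReal] at h
    exact_mod_cast h
  obtain ⟨y, hy, hxy⟩ := Function.Periodic.exists_mem_Ico₀ (f := fun x => ‖f x‖) hper hT x
  have hpos := intervalIntegral.integral_pos (f := fun x => ‖f x‖ ^ 2) hT
    (by fun_prop) (fun _ _ => by positivity)
    ⟨y, Set.Ico_subset_Icc_self hy, by
      have : 0 < ‖f x‖ := norm_pos_iff.mpr hx
      change ‖f x‖ = ‖f y‖ at hxy
      rw [hxy] at this; positivity⟩
  exact hpos.ne' h'

variable [CompleteSpace H]

theorem intervalIntegral_inner_right {f : ℝ → H} (hf : Continuous f) (c : H) (a b : ℝ) :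
    ∫ y in a..b, inner ℂ c (f y) = inner ℂ c (∫ y in a..b, f y) :=
  (innerSL ℂ c).intervalIntegral_comp_comm (hf.intervalIntegrable a b)

theorem intervalIntegral_inner_left {f : ℝ → H} (hf : Continuous f) (c : H) (a b : ℝ) :
    ∫ y in a..b, inner ℂ (f y) c = inner ℂ (∫ y in a..b, f y) c := by
  rw [← inner_conj_symm, ← intervalIntegral_inner_right hf, ← intervalIntegral.intervalIntegral_conj]
  simp only [inner_conj_symm]

end Inner

/-! ### Self-adjointness of the heat kernel and the heat equation in the second variable. -/

section Symmetry

variable {H : Type*} [NormedAddCommGroup H] [InnerProductSpace ℂ H]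

/-- The heat kernel of `-D² + Q` on quasi-periodic functions of period `T` with unitary
holonomy `ρ`, as a function of `(t, x, y)`. -/
structure IsTwoPointHeatKernel (T : ℝ) (ρ : H →L[ℂ] H) (Q : ℝ → H →L[ℂ] H)
    (P : ℝ × ℝ × ℝ → H →L[ℂ] H) : Prop where
  smooth : ContDiffOn ℝ ∞ P posTime
  left_section : ∀ t, 0 < t → ∀ x y, P (t, x + T, y) = ρ * P (t, x, y)
  right_section : ∀ t, 0 < t → ∀ x y, P (t, x, y + T) * ρ = P (t, x, y)
  heat : ∀ t, 0 < t → ∀ x y, dT P (t, x, y) = dX (dX P) (t, x, y) - Q x * P (t, x, y)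
  initial : ∀ f : ℝ → H, ContDiff ℝ ∞ f → (∀ x, f (x + T) = ρ (f x)) →
    TendstoUniformly (fun t x => ∫ y in (0 : ℝ)..T, P (t, x, y) (f y)) f (𝓝[>] (0 : ℝ))

namespace IsTwoPointHeatKernel

variable {T : ℝ} {ρ : H →L[ℂ] H} {Q : ℝ → H →L[ℂ] H} {P : ℝ × ℝ × ℝ → H →L[ℂ] H}

theorem continuous_slice (hP : IsTwoPointHeatKernel T ρ Q P) {t : ℝ} (ht : 0 < t) :
    Continuous (fun p : ℝ × ℝ => P (t, p.1, p.2)) :=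
  continuousOn_univ.mp (hP.smooth.continuousOn.comp (f := fun p : ℝ × ℝ => (t, p.1, p.2))
    (by fun_prop) fun _ _ => mem_posTime ht)

theorem contDiff_slice (hP : IsTwoPointHeatKernel T ρ Q P) {t : ℝ} (ht : 0 < t) :
    ContDiff ℝ ∞ (fun p : ℝ × ℝ => P (t, p.1, p.2)) :=
  contDiffOn_univ.mp (hP.smooth.comp (f := fun p : ℝ × ℝ => (t, p.1, p.2))
    (by fun_prop) fun _ _ => mem_posTime ht)

variable [CompleteSpace H]

/-- The composition `U(s)^* U(r)` as a kernel. -/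
noncomputable def adjointComp (T : ℝ) (P : ℝ × ℝ × ℝ → H →L[ℂ] H) (s r x y : ℝ) : H →L[ℂ] H :=
  ∫ z in (0 : ℝ)..T, star (P (s, z, x)) * P (r, z, y)

theorem star_adjointComp (T : ℝ) (P : ℝ × ℝ × ℝ → H →L[ℂ] H) (s r x y : ℝ) :
    star (adjointComp T P s r x y) = adjointComp T P r s y x := by
  unfold adjointComp
  rw [show ∀ A : H →L[ℂ] H, star A = (starL' ℝ : (H →L[ℂ] H) ≃L[ℝ] (H →L[ℂ] H)) A from fun _ => rfl]
  simp only [intervalIntegral, map_sub, ← ContinuousLinearEquiv.integral_comp_comm]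
  simp

theorem left_section_dX (hP : IsTwoPointHeatKernel T ρ Q P) {t : ℝ} (ht : 0 < t) (x y : ℝ) :
    dX P (t, x + T, y) = ρ * dX P (t, x, y) :=
  ((hasDerivAt_dX hP.smooth ht (x + T) y).comp_add_const x T).unique
    (((hasDerivAt_dX hP.smooth ht x y).const_mul ρ).congr_of_eventuallyEq
      (Eventually.of_forall fun z => hP.left_section t ht z y))

/-- Green's formula: as $Q$ is Hermitian, the potential terms cancel and the $r$-derivative of the
integrand is the $z$-derivative of a Wronskian, whose values at both ends of the period agree
because $\rho^*\rho=1$. -/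
theorem hasDerivAt_adjointComp (hP : IsTwoPointHeatKernel T ρ Q P) (hρ : star ρ * ρ = 1)
    (hQ : ∀ x, IsSelfAdjoint (Q x)) {t r : ℝ} (hr : r ∈ Set.Ioo 0 t) (x y : ℝ) :
    HasDerivAt (fun r => adjointComp T P (t - r) r x y) 0 r := by
  have hT : ContDiffOn ℝ ∞ (dT P) posTime := contDiffOn_dirDeriv isOpen_posTime hP.smooth _
  have hX : ContDiffOn ℝ ∞ (dX P) posTime := contDiffOn_dirDeriv isOpen_posTime hP.smooth _
  have c₁ : ∀ {R : ℝ × ℝ × ℝ → H →L[ℂ] H}, ContDiffOn ℝ ∞ R posTime →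
      ContinuousOn (fun p : ℝ × ℝ => star (R (t - p.1, p.2, x))) (Set.Ioo 0 t ×ˢ Set.univ) :=
    fun hR => (hR.continuousOn.comp (f := fun p : ℝ × ℝ => (t - p.1, p.2, x)) (by fun_prop)
      fun p hp => mem_posTime (sub_pos.mpr hp.1.2)).star
  have c₂ : ∀ {R : ℝ × ℝ × ℝ → H →L[ℂ] H}, ContDiffOn ℝ ∞ R posTime →
      ContinuousOn (fun p : ℝ × ℝ => R (p.1, p.2, y)) (Set.Ioo 0 t ×ˢ Set.univ) :=
    fun hR => hR.continuousOn.comp (f := fun p : ℝ × ℝ => (p.1, p.2, y)) (by fun_prop)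
      fun p hp => mem_posTime hp.1.1
  have hr₁ : 0 < t - r := sub_pos.mpr hr.2
  have main := hasDerivAt_intervalIntegral_param
    (F := fun r z => star (P (t - r, z, x)) * P (r, z, y))
    (F' := fun r z => -star (dT P (t - r, z, x)) * P (r, z, y)
      + star (P (t - r, z, x)) * dT P (r, z, y))
    isOpen_Ioo ((c₁ hP.smooth).mul (c₂ hP.smooth))
    (((c₁ hT).neg.mul (c₂ hP.smooth)).add ((c₁ hP.smooth).mul (c₂ hT)))
    (fun r hr z => by
      have h₁ : HasDerivAt (fun s => P (t - s, z, x)) (-dT P (t - r, z, x)) r :=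
        ((hasDerivAt_dT hP.smooth (sub_pos.mpr hr.2) z x).scomp r
          ((hasDerivAt_id r).const_sub t)).congr_deriv (by simp)
      exact (h₁.star.mul (hasDerivAt_dT hP.smooth hr.1 z y)).congr_deriv (by simp)) hr 0 T
  refine main.congr_deriv ?_
  have hΦ : ∀ z, HasDerivAt
      (fun z => star (P (t - r, z, x)) * dX P (r, z, y) - star (dX P (t - r, z, x)) * P (r, z, y))
      (-star (dT P (t - r, z, x)) * P (r, z, y) + star (P (t - r, z, x)) * dT P (r, z, y)) z := by
    intro z
    refine (((hasDerivAt_dX hP.smooth hr₁ z x).star.mul (hasDerivAt_dX hX hr.1 z y)).sub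
      ((hasDerivAt_dX hX hr₁ z x).star.mul (hasDerivAt_dX hP.smooth hr.1 z y))).congr_deriv ?_
    rw [hP.heat _ hr₁, hP.heat _ hr.1, star_sub, star_mul, (hQ z).star_eq]
    noncomm_ring
  have slice : ContinuousOn (fun z => -star (dT P (t - r, z, x)) * P (r, z, y)
      + star (P (t - r, z, x)) * dT P (r, z, y)) Set.univ :=
    (((c₁ hT).neg.mul (c₂ hP.smooth)).add ((c₁ hP.smooth).mul (c₂ hT))).comp
      (f := fun z : ℝ => (r, z)) (by fun_prop) fun z _ => ⟨hr, trivial⟩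
  -- Writing the endpoint as $0+T$ lets the section law compare it with the endpoint $0$.
  rw [intervalIntegral.integral_eq_sub_of_hasDerivAt (fun z _ => hΦ z)
    ((continuousOn_univ.mp slice).intervalIntegrable _ _), ← zero_add T, hP.left_section _ hr₁,
    hP.left_section _ hr.1, hP.left_section_dX hr₁, hP.left_section_dX hr.1, sub_eq_zero]
  simp only [star_mul]
  have e : ∀ B C : H →L[ℂ] H, star B * star ρ * (ρ * C) = star B * C := fun B C => by
    rw [mul_assoc, ← mul_assoc (star ρ), hρ, one_mul]
  rw [e, e]

theorem adjointComp_eq (hP : IsTwoPointHeatKernel T ρ Q P) (hρ : star ρ * ρ = 1)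
    (hQ : ∀ x, IsSelfAdjoint (Q x)) {t r s : ℝ} (hr : r ∈ Set.Ioo 0 t) (hs : s ∈ Set.Ioo 0 t)
    (x y : ℝ) : adjointComp T P (t - r) r x y = adjointComp T P (t - s) s x y :=
  isOpen_Ioo.is_const_of_deriv_eq_zero (f := fun r => adjointComp T P (t - r) r x y)
    isPreconnected_Ioo
    (fun _ hr => (hP.hasDerivAt_adjointComp hρ hQ hr x y).differentiableAt.differentiableWithinAt)
    (fun _ hr => (hP.hasDerivAt_adjointComp hρ hQ hr x y).deriv) hr hs

theorem continuous_star_mul (hP : IsTwoPointHeatKernel T ρ Q P) {s r : ℝ} (hs : 0 < s) (hr : 0 < r)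
    (x y : ℝ) : Continuous fun z => star (P (s, z, x)) * P (r, z, y) :=
  ((hP.continuous_slice hs).comp (f := fun z => (z, x)) (by fun_prop)).star.mul
    ((hP.continuous_slice hr).comp (f := fun z => (z, y)) (by fun_prop))

theorem adjointComp_apply (hP : IsTwoPointHeatKernel T ρ Q P) {s r : ℝ} (hs : 0 < s) (hr : 0 < r)
    (x y : ℝ) (w : H) :
    adjointComp T P s r x y w = ∫ z in (0 : ℝ)..T, (star (P (s, z, x)) * P (r, z, y)) w := by
  exact ((ContinuousLinearMap.apply ℂ H w).intervalIntegral_comp_comm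
    ((hP.continuous_star_mul hs hr x y).intervalIntegrable 0 T)).symm

/-- Fubini moves $U(s)$ from the kernel onto the test function, where the initial condition applies
as $s\to0$. -/
theorem intervalIntegral_inner_adjointComp (hP : IsTwoPointHeatKernel T ρ Q P) {s r : ℝ}
    (hs : 0 < s) (hr : 0 < r) {f : ℝ → H} (hf : Continuous f) (y : ℝ) (w : H) :
    ∫ x in (0 : ℝ)..T, inner ℂ (f x) (adjointComp T P s r x y w) =
      ∫ z in (0 : ℝ)..T, inner ℂ (∫ x in (0 : ℝ)..T, P (s, z, x) (f x)) (P (r, z, y) w) := by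
  have h₁ : Continuous fun p : ℝ × ℝ => P (s, p.2, p.1) :=
    (hP.continuous_slice hs).comp (f := fun p : ℝ × ℝ => (p.2, p.1)) (by fun_prop)
  have h₂ : Continuous fun p : ℝ × ℝ => P (r, p.2, y) :=
    (hP.continuous_slice hr).comp (f := fun p : ℝ × ℝ => (p.2, y)) (by fun_prop)
  have hcont : Continuous fun p : ℝ × ℝ => inner ℂ (P (s, p.2, p.1) (f p.1)) (P (r, p.2, y) w) :=
    (h₁.clm_apply (hf.comp continuous_fst)).inner (h₂.clm_apply continuous_const)
  have e : ∀ x, inner ℂ (f x) (adjointComp T P s r x y w) =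
      ∫ z in (0 : ℝ)..T, inner ℂ (P (s, z, x) (f x)) (P (r, z, y) w) := fun x => by
    have h₃ := h₁.comp (f := fun z => (x, z)) (by fun_prop)
    have h₄ := h₂.comp (f := fun z => (x, z)) (by fun_prop)
    rw [hP.adjointComp_apply hs hr, ← intervalIntegral_inner_right]
    · simp only [mul_apply_eq_comp, ContinuousLinearMap.star_eq_adjoint,
        ContinuousLinearMap.adjoint_inner_right]
    · exact (h₃.star.mul h₄).clm_apply continuous_const
  simp only [e]
  rw [MeasureTheory.intervalIntegral_intervalIntegral_swap]
  · congr 1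
    ext z
    refine intervalIntegral_inner_left ?_ _ _ _
    exact (h₁.comp (f := fun x => (x, z)) (by fun_prop)).clm_apply hf
  · exact (hcont.continuousOn.integrableOn_compact
      (isCompact_uIcc.prod isCompact_uIcc)).mono_set
      (Set.prod_mono Set.uIoc_subset_uIcc Set.uIoc_subset_uIcc)

/-- Pairing `U(t)` with the initial data in the semigroup identity. -/
theorem intervalIntegral_inner_semigroup (hP : IsTwoPointHeatKernel T ρ Q P)
    (hρ : star ρ * ρ = 1) (hQ : ∀ x, IsSelfAdjoint (Q x)) {t s : ℝ} (hs : s ∈ Set.Ioo 0 t)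
    {f : ℝ → H} (hf : ContDiff ℝ ∞ f) (hfs : ∀ x, f (x + T) = ρ (f x)) (y : ℝ) (w : H) :
    ∫ x in (0 : ℝ)..T, inner ℂ (f x) (adjointComp T P (t - s) s x y w) =
      ∫ z in (0 : ℝ)..T, inner ℂ (f z) (P (t, z, y) w) := by
  have ht : 0 < t := hs.1.trans hs.2
  -- Staying above $t/2$ keeps $r$ in a compact set of positive times, where $P(r,z,y)w$ is bounded.
  have hev : ∀ᶠ r in 𝓝[<] t, r ∈ Set.Ioo (t / 2) t :=
    Ioo_mem_nhdsLT (half_lt_self ht)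
  have hconst : ∀ᶠ r in 𝓝[<] t,
      ∫ z in (0 : ℝ)..T, inner ℂ (∫ x in (0 : ℝ)..T, P (t - r, z, x) (f x)) (P (r, z, y) w) =
        ∫ x in (0 : ℝ)..T, inner ℂ (f x) (adjointComp T P (t - s) s x y w) := by
    filter_upwards [hev] with r hr
    have hr' : r ∈ Set.Ioo 0 t := ⟨(half_pos ht).trans hr.1, hr.2⟩
    rw [← hP.intervalIntegral_inner_adjointComp (sub_pos.mpr hr.2) hr'.1 hf.continuous]
    simp only [hP.adjointComp_eq hρ hQ hr' hs]
  refine tendsto_nhds_unique (tendsto_const_nhds.congr' (EventuallyEq.symm hconst)) ?_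
  have hsub : Tendsto (fun r => t - r) (𝓝[<] t) (𝓝[>] 0) := by
    refine tendsto_nhdsWithin_iff.mpr ⟨?_, ?_⟩
    · exact tendsto_nhdsWithin_of_tendsto_nhds
        (by simpa using (continuous_const.sub continuous_id).tendsto (f := fun r : ℝ => t - r) t)
    · filter_upwards [self_mem_nhdsWithin] with r (hr : r < t) using sub_pos.mpr hr
  have hu : TendstoUniformly (fun r z => ∫ x in (0 : ℝ)..T, P (t - r, z, x) (f x)) f (𝓝[<] t) :=
    fun u hu => hsub.eventually (hP.initial f hf hfs u hu)
  -- Dominating constants: $C+1$ for $U(t-r)f$ by uniform convergence to $f$, and $D$ for the other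
  -- factor.
  obtain ⟨C, hC⟩ := (isCompact_uIcc (a := 0) (b := T)).exists_bound_of_continuousOn
    hf.continuous.continuousOn
  have hCb : ∀ᶠ r in 𝓝[<] t, ∀ z ∈ Set.uIcc 0 T,
      ‖∫ x in (0 : ℝ)..T, P (t - r, z, x) (f x)‖ ≤ C + 1 := by
    filter_upwards [Metric.tendstoUniformly_iff.mp hu 1 one_pos] with r hr z hz
    have h₁ := hr z
    rw [dist_comm, dist_eq_norm] at h₁
    have h₂ := norm_le_norm_add_norm_sub' (∫ x in (0 : ℝ)..T, P (t - r, z, x) (f x)) (f z)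
    linarith [hC z hz]
  have hPc : ContinuousOn (fun p : ℝ × ℝ => P (p.1, p.2, y) w) (Set.Ioi 0 ×ˢ Set.univ) :=
    (hP.smooth.continuousOn.comp (f := fun p : ℝ × ℝ => (p.1, p.2, y)) (by fun_prop)
      fun p hp => mem_posTime hp.1).clm_apply continuousOn_const
  obtain ⟨D, hD⟩ := ((isCompact_Icc (a := t / 2) (b := t)).prod
    (isCompact_uIcc (a := 0) (b := T))).exists_bound_of_continuousOn
    (hPc.mono (Set.prod_mono (fun r hr => (half_pos ht).trans_le hr.1) (Set.subset_univ _)))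
  refine intervalIntegral.tendsto_integral_filter_of_dominated_convergence
    (fun _ => (C + 1) * D) ?_ ?_ intervalIntegrable_const ?_
  · filter_upwards [hev] with r hr
    have h₁ := hP.continuous_slice (sub_pos.mpr hr.2)
    have h₂ : Continuous fun z => P (r, z, y) :=
      (hP.continuous_slice ((half_pos ht).trans hr.1)).comp (f := fun z => (z, y)) (by fun_prop)
    have h₃ : Continuous fun z => ∫ x in (0 : ℝ)..T, P (t - r, z, x) (f x) :=
      intervalIntegral.continuous_parametric_intervalIntegral_of_continuous'
        (f := fun z x => P (t - r, z, x) (f x))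
        (h₁.clm_apply (hf.continuous.comp continuous_snd)) 0 T
    exact (h₃.inner (h₂.clm_apply continuous_const)).aestronglyMeasurable
  · filter_upwards [hev, hCb] with r hr hb
    refine Eventually.of_forall fun z hz => ?_
    have hz' := Set.uIoc_subset_uIcc hz
    exact (norm_inner_le_norm _ _).trans (mul_le_mul (hb z hz')
      (hD (r, z) ⟨Set.Ioo_subset_Icc_self hr, hz'⟩) (norm_nonneg _)
      ((norm_nonneg _).trans (hb z hz')))
  · refine Eventually.of_forall fun z _ => (hu.tendsto_at z).inner ?_
    exact tendsto_nhdsWithin_of_tendsto_nhds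
      (((hasDerivAt_dT hP.smooth ht z y).continuousAt).clm_apply continuousAt_const)

/-- The semigroup identity `U(t) = U(t - s)^* U(s)`. -/
theorem eq_adjointComp (hP : IsTwoPointHeatKernel T ρ Q P) (hT : 0 < T)
    (hρ : star ρ * ρ = 1) (hρ' : ρ * star ρ = 1) (hQ : ∀ x, IsSelfAdjoint (Q x)) {t s : ℝ}
    (hs : s ∈ Set.Ioo 0 t) (x y : ℝ) :
    P (t, x, y) = adjointComp T P (t - s) s x y := by
  have ht : 0 < t := hs.1.trans hs.2
  have hts : 0 < t - s := sub_pos.mpr hs.2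
  ext1 w
  have heval : ContDiff ℝ ∞ fun A : H →L[ℂ] H => A w :=
    ((ContinuousLinearMap.apply ℂ H w).restrictScalars ℝ).contDiff
  have hsmooth : ContDiff ℝ ∞ fun x => adjointComp T P (t - s) s x y w := by
    rw [funext fun x => hP.adjointComp_apply hts hs.1 x y w]
    refine contDiff_intervalIntegral_param
      (F := fun p => (star (P (t - s, p.2, p.1)) * P (s, p.2, y)) w) ?_ 0 T
    have h₁ : ContDiff ℝ ∞ fun p : ℝ × ℝ => P (t - s, p.2, p.1) :=
      (hP.contDiff_slice hts).comp (f := fun p : ℝ × ℝ => (p.2, p.1)) (by fun_prop)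
    have h₂ : ContDiff ℝ ∞ fun p : ℝ × ℝ => P (s, p.2, y) :=
      (hP.contDiff_slice hs.1).comp (f := fun p : ℝ × ℝ => (p.2, y)) (by fun_prop)
    exact heval.comp (((starL' ℝ : (H →L[ℂ] H) ≃L[ℝ] (H →L[ℂ] H)).contDiff.comp h₁).mul h₂)
  have hsmooth' : ContDiff ℝ ∞ fun x => P (t, x, y) w :=
    heval.comp ((hP.contDiff_slice ht).comp (f := fun x : ℝ => (x, y)) (by fun_prop))
  have hsec : ∀ x, adjointComp T P (t - s) s (x + T) y = ρ * adjointComp T P (t - s) s x y := by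
    intro x
    have h : ∀ z, star (P (t - s, z, x + T)) = ρ * star (P (t - s, z, x)) := fun z => by
      rw [← hP.right_section _ hts z x, star_mul, ← mul_assoc, hρ', one_mul]
    unfold adjointComp
    simp only [h, mul_assoc]
    exact (ContinuousLinearMap.mul ℝ (H →L[ℂ] H) ρ).intervalIntegral_comp_comm
      ((hP.continuous_star_mul hts hs.1 x y).intervalIntegrable 0 T)
  -- The difference of the two sides is itself a smooth section, so it may be used as the test
  -- function; it is then orthogonal to itself.
  set M : ℝ → H := fun x => adjointComp T P (t - s) s x y w - P (t, x, y) w with hM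
  have hMs : ContDiff ℝ ∞ M := hsmooth.sub hsmooth'
  have hMsec : ∀ x, M (x + T) = ρ (M x) := fun x => by
    simp [hM, hsec, hP.left_section t ht]
  have hnorm : ∀ x, ‖M (x + T)‖ = ‖M x‖ := fun x => by
    rw [hMsec]
    exact ContinuousLinearMap.norm_map_of_mem_unitary (u := ρ) (H := H) ⟨hρ, hρ'⟩ _
  have hint : ∫ x in (0 : ℝ)..T, inner ℂ (M x) (M x) = 0 := by
    have h := hP.intervalIntegral_inner_semigroup hρ hQ hs hMs hMsec y w
    have hc := hMs.continuous
    have hc₁ := hsmooth.continuous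
    have hc₂ := hsmooth'.continuous
    rw [← sub_eq_zero, ← intervalIntegral.integral_sub
      ((hc.inner hc₁).intervalIntegrable _ _) ((hc.inner hc₂).intervalIntegrable _ _)] at h
    simpa only [← inner_sub_right] using h
  exact (sub_eq_zero.mp
    (eq_zero_of_intervalIntegral_inner_self hMs.continuous hT hnorm hint x)).symm

/-- The heat kernel is self-adjoint: `U(t; x, y)^* = U(t; y, x)`. -/
theorem star_eq (hP : IsTwoPointHeatKernel T ρ Q P) (hT : 0 < T)
    (hρ : star ρ * ρ = 1) (hρ' : ρ * star ρ = 1) (hQ : ∀ x, IsSelfAdjoint (Q x)) {t : ℝ}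
    (ht : 0 < t) (x y : ℝ) : star (P (t, x, y)) = P (t, y, x) := by
  -- The midpoint is the splitting with $t-s=s$, for which taking adjoints only swaps $x$ and $y$.
  have hs : t / 2 ∈ Set.Ioo 0 t := ⟨half_pos ht, half_lt_self ht⟩
  rw [hP.eq_adjointComp hT hρ hρ' hQ hs, hP.eq_adjointComp hT hρ hρ' hQ hs, star_adjointComp,
    sub_half]

/-- The heat equation in the second space variable. -/
theorem heat_right (hP : IsTwoPointHeatKernel T ρ Q P) (hT : 0 < T)
    (hρ : star ρ * ρ = 1) (hρ' : ρ * star ρ = 1) (hQ : ∀ x, IsSelfAdjoint (Q x)) {t : ℝ}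
    (ht : 0 < t) (x y : ℝ) :
    dT P (t, x, y) = dY (dY P) (t, x, y) - P (t, x, y) * Q y := by
  have hX : ContDiffOn ℝ ∞ (dX P) posTime := contDiffOn_dirDeriv isOpen_posTime hP.smooth _
  have hY : ContDiffOn ℝ ∞ (dY P) posTime := contDiffOn_dirDeriv isOpen_posTime hP.smooth _
  have symm : ∀ s, 0 < s → ∀ x y, P (s, x, y) = star (P (s, y, x)) := fun s hs x y =>
    (hP.star_eq hT hρ hρ' hQ hs y x).symm
  have eT : dT P (t, x, y) = star (dT P (t, y, x)) :=
    (hasDerivAt_dT hP.smooth ht x y).unique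
      ((hasDerivAt_dT hP.smooth ht y x).star.congr_of_eventuallyEq
        (by filter_upwards [lt_mem_nhds ht] with s hs using symm s hs x y))
  have eY : ∀ y, dY P (t, x, y) = star (dX P (t, y, x)) := fun y =>
    (hasDerivAt_dY hP.smooth ht x y).unique
      ((hasDerivAt_dX hP.smooth ht y x).star.congr_of_eventuallyEq
        (Eventually.of_forall fun z => symm t ht x z))
  have eYY : dY (dY P) (t, x, y) = star (dX (dX P) (t, y, x)) :=
    (hasDerivAt_dY hY ht x y).unique
      ((hasDerivAt_dX hX ht y x).star.congr_of_eventuallyEq (Eventually.of_forall eY))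
  rw [eT, hP.heat t ht, eYY, star_sub, star_mul, (hQ y).star_eq, ← symm t ht x y]

end IsTwoPointHeatKernel

end Symmetry


/-! ### Application to the matrix heat kernel on the circle. -/

theorem IsHeatKernel.isTwoPointHeatKernel {N : ℕ} {a : ℝ} {ρ : FiberEnd N} {Q : ℝ → FiberEnd N}
    {U : ℝ → ℝ → ℝ → FiberEnd N} (hU : IsHeatKernel a ρ Q U) :
    IsTwoPointHeatKernel (H := Fiber N) (2 * Real.pi * a) ρ Q (fun p => U p.1 p.2.1 p.2.2) where
  smooth := hU.smooth
  left_section := hU.left_section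
  right_section := hU.right_section
  initial := hU.initial
  heat t ht x y := by
    have hP := hU.smooth
    set P : ℝ × ℝ × ℝ → FiberEnd N := fun p => U p.1 p.2.1 p.2.2
    have hX : ContDiffOn ℝ ∞ (dX P) posTime := contDiffOn_dirDeriv isOpen_posTime hP _
    have h := hU.heat_equation t ht x y
    have e₁ : deriv (fun s => U s x y) t = dT P (t, x, y) := (hasDerivAt_dT hP ht x y).deriv
    have e₂ : iteratedDeriv 2 (fun z => U t z y) x = dX (dX P) (t, x, y) := by
      rw [iteratedDeriv_succ, iteratedDeriv_one,
        show deriv (fun z => U t z y) = fun z => dX P (t, z, y) from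
          funext fun z => (hasDerivAt_dX hP ht z y).deriv]
      exact (hasDerivAt_dX hX ht x y).deriv
    rw [schrodinger, e₁, e₂] at h
    have h' := eq_neg_of_add_eq_zero_left h
    rw [neg_add, neg_neg, ← sub_eq_add_neg] at h'
    exact h'

/-- Here $q,q'$ stand for $Q,Q'$, $g$ for $[U]$, $u,v$ for $\partial_xU,\partial_yU$ on the diagonal
and $i$ for $D^3[U]$; thus $D[U]=u+v$ and $W=u-v$. -/
theorem third_order_identity {A : Type*} [Ring A] (q q' g u v i : A) :
    i - q' * g - g * q' - q * u - 3 * (q * v) - 3 * (u * q) - v * q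
      - (i - 2 * (q * (u + v)) - 2 * (q' * g + q * (u + v)) + (q * (u + v) - (u + v) * q)
        + (q' * g + q * (u + v) - ((u + v) * q + g * q')) + (q * (u - v) - (u - v) * q)) = 0 := by
  noncomm_ring

/-- Every endomorphism of a line is a scalar, so all $\mathrm{Ad}_Q$ terms vanish in rank one. -/
theorem fiberEnd_one_mul_comm (A B : FiberEnd 1) : A * B = B * A := by
  have key : ∀ (A : FiberEnd 1) (v : Fiber 1), A v = (A (EuclideanSpace.single 0 1) 0) • v := by
    intro A v
    have hv : v = v 0 • EuclideanSpace.single (0 : Fin 1) (1 : ℂ) := by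
      ext i; fin_cases i; simp
    rw [hv, map_smul]
    ext i; fin_cases i; simp [mul_comm]
  ext1 v
  change A (B v) = B (A v)
  rw [key A (B v), key A v, map_smul]

end CircleHeat

theorem mainTheorem2 (N : ℕ) (a : ℝ) (ha : 0 < a)
    (ρ : CircleHeat.FiberEnd N) (hρ : ρ ∈ unitary (CircleHeat.FiberEnd N))
    (Q : ℝ → CircleHeat.FiberEnd N) (hQ : ContDiff ℝ ∞ Q)
    (hQsec : CircleHeat.IsEndSection a ρ Q) (hQherm : ∀ x, IsSelfAdjoint (Q x))
    (U : ℝ → ℝ → ℝ → CircleHeat.FiberEnd N) (hU : CircleHeat.IsHeatKernel a ρ Q U) :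
    (∀ t, 0 < t → ∀ x,
      HasDerivAt (CircleHeat.kernelW U t)
        (CircleHeat.adQ Q (CircleHeat.diagonal U t) x) x) ∧
    (∀ t, 0 < t → ∀ x,
      4 * deriv (fun s => deriv (CircleHeat.diagonal U s) x) t
        - CircleHeat.opE Q (CircleHeat.diagonal U t) (CircleHeat.kernelW U t) x = 0) ∧
    (N = 1 → ∀ (F G : ℝ → CircleHeat.FiberEnd N) (x : ℝ),
      CircleHeat.opE Q F G x = CircleHeat.scalarE Q F x) := by
  open CircleHeat in
  have hP := hU.isTwoPointHeatKernel
  have hsm := hU.smooth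
  have h₁ := hP.heat
  have h₂ := fun t ht => hP.heat_right (t := t) (by positivity) hρ.1 hρ.2 hQherm ht
  set P : ℝ × ℝ × ℝ → FiberEnd N := fun p => U p.1 p.2.1 p.2.2
  have hW : ∀ t, 0 < t → kernelW U t = fun x => dX P (t, x, x) - dY P (t, x, x) :=
    fun t ht => funext fun x => congrArg₂ (· - ·) (hasDerivAt_dX hsm ht x x).deriv
      (hasDerivAt_dY hsm ht x x).deriv
  refine ⟨fun t ht x => ?_, fun t ht x => ?_, ?_⟩
  · rw [hW t ht]
    exact hasDerivAt_antisymm hsm h₁ h₂ ht x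
  · have key := deriv_diag_third_order hsm hQ h₁ h₂ ht x
    have hG : HasDerivAt (diagonal U t) (dX P (t, x, x) + dY P (t, x, x)) x :=
      hasDerivAt_diag hsm ht x
    have hq : HasDerivAt Q (deriv Q x) x := (hQ.differentiable (by simp) x).hasDerivAt
    have d₁ : deriv (fun y => Q y * diagonal U t y) x = _ := (hq.mul hG).deriv
    have d₂ : deriv (adQ Q (diagonal U t)) x = _ := ((hq.mul hG).sub (hG.mul hq)).deriv
    have key' : 4 * deriv (fun s => deriv (diagonal U s) x) t = _ := key
    rw [key', opE, d₁, d₂, hW t ht]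
    simp only [adQ]
    rw [hG.deriv]
    exact third_order_identity _ _ _ _ _ _
  · rintro rfl F G x
    have hz : ∀ F : ℝ → FiberEnd 1, adQ Q F = fun _ => 0 := fun F => funext fun y =>
      sub_eq_zero.mpr (fiberEnd_one_mul_comm _ _)
    simp [opE, scalarE, hz]
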